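/- A graph $\Gamma$ here is a directed graph with vertex set $V_\Gamma$ and edge set $E_\Gamma$, possibly with loops and multiple edges, with weights $w(e)\in\mathbb{Z}_{>0}$; the weight $w(p)$ of a walk $p$ is the sum of the weights of its edges. A periodic graph $(\Gamma,L)$ is such a graph together with a free abelian group $L$ of finite rank acting freely on $V_\Gamma$ and on $E_\Gamma$, compatibly with sources, targets and weights, such that $V_\Gamma/L$ and $E_\Gamma/L$ are finite. Let $\Gamma/L$ be the quotient graph, $\overline{x}$ the class of $x\in V_\Gamma$, and $L_{\mathbb R}=L\otimes_{\mathbb Z}\mathbb R$. A cycle in $\Gamma/L$ is a closed walk $e_1\cdots e_\ell$ with $\ell\ge 1$ whose vertices $t(e_1),\dots,t(e_\ell)$ are distinct. For a cycle $q$ let $\mu(q)\in L$ be the element $u$ with $t(p)=u+s(p)$, where $p$ is any lift of $q$ to a walk in $\Gamma$, and put $\nu(q)=\mu(q)/w(q)\in L_{\mathbb R}$. The growth polytope is $P_\Gamma=\operatorname{conv}(\{\nu(q) : q \text{ a cycle in }\Gamma/L\}\cup\{0\})$, and $V(P_\Gamma)$ is its set of vertices. A vertex $x_0\in V_\Gamma$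 is $P$-initial if for every $v\in V(P_\Gamma)\setminus\{0\}$ there is a cycle $q$ in $\Gamma/L$ passing through $\overline{x_0}$ with $\nu(q)=v$. Let $d_\Gamma(x,y)\in\mathbb{Z}_{\ge0}\cup\{\infty\}$ be the least weight of a walk from $x$ to $y$; the growth sequence from $x_0$ is $s_i=\#\{y\in V_\Gamma : d_\Gamma(x_0,y)=i\}$, and the growth series is $G_{\Gamma,x_0}(t)=\sum_{i\ge0}s_it^i$. A positive integer $N$ is a quasi-period of a sequence $(g_i)_{i\ge 0}$ if there are polynomials $Q_0,\dots,Q_{N-1}\in\mathbb{C}[x]$ with $g_i=Q_r(i)$ for all sufficiently large $i$ and all $r\in\{0,\dots,N-1\}$ with $i\equiv r \pmod N$. **Theorem.** Let $(\Gamma,L)$ be a periodic graph and let $x_0\in V_\Gamma$ be $P$-initial. For each $v\in V(P_\Gamma)\setminus\{0\}$ choose a cycle $q_v$ in $\Gamma/L$ with $\nu(q_v)=v$ passing through $\overline{x_0}$. Then $$\operatorname{LCM}\{w(q_v) : v\in V(P_\Gamma)\setminus\{0\}\}$$ is a quasi-period of the growth sequence $(s_i)_i$, and more precisely $$G_{\Gamma,x_0}(t)=\frac{Q(t)}{\prod_{v\in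 V(P_\Gamma)\setminus\{0\}}\bigl(1-t^{w(q_v)}\bigr)}$$ for some polynomial $Q(t)\in\mathbb{Z}[t]$. In particular, if $w(e)=1$ for every edge $e$, then $\operatorname{LCM}\{1,2,\dots,\#(V_\Gamma/L)\}$ is a quasi-period of the growth sequence. -/

import Mathlib

open scoped TensorProduct

/-- A directed weighted graph, possibly with loops and multiple edges. -/
structure WGraph (V E : Type*) where
  /-- source -/
  s : E → V
  /-- target -/
  t : E → V
  /-- weight -/
  w : E → ℕ
  w_pos : ∀ e, 0 < w e

namespace WGraph

variable {V E : Type*} (Γ : WGraph V E)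

/-- `Γ.IsWalk x p y`: the sequence of edges `p` is a walk from `x` to `y`.
The empty sequence is the trivial walk from `x` to `x`. -/
def IsWalk : V → List E → V → Prop
  | x, [], y => x = y
  | x, e :: p, y => Γ.s e = x ∧ IsWalk (Γ.t e) p y

/-- The weight of a walk. -/
def weight (p : List E) : ℕ := (p.map Γ.w).sum

/-- A cycle: a nontrivial closed walk `e₁ ⋯ e_ℓ` with `t(e₁), …, t(e_ℓ)` distinct. -/
def IsCycle (p : List E) : Prop :=
  p ≠ [] ∧ (∃ x, Γ.IsWalk x p x) ∧ (p.map Γ.t).Nodup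

/-- The set of vertices visited by a nontrivial walk. -/
def supp (p : List E) : Set V := {x | ∃ e ∈ p, Γ.s e = x ∨ Γ.t e = x}

/-- `d(x, y)`: the least weight of a walk from `x` to `y`, and `⊤` if there is none. -/
noncomputable def dist (x y : V) : ℕ∞ :=
  ⨅ (p : List E) (_ : Γ.IsWalk x p y), (Γ.weight p : ℕ∞)

/-- The sphere `{y | d(x₀, y) = i}`. -/
def sphere (x₀ : V) (i : ℕ) : Set V := {y | Γ.dist x₀ y = i}

/-- The growth sequence with start point `x₀` (for a periodic graph the spheres are finite:
`PeriodicGraph.finite_sphere`). -/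
noncomputable def growthSeq (x₀ : V) (i : ℕ) : ℕ := (Γ.sphere x₀ i).ncard

/-- The growth series `∑ sᵢ tⁱ`. -/
noncomputable def growthSeries (x₀ : V) : PowerSeries ℤ :=
  PowerSeries.mk fun i => (Γ.growthSeq x₀ i : ℤ)

/-- All weights are `1`. -/
def Unweighted : Prop := ∀ e, Γ.w e = 1

end WGraph

/-- A periodic graph with vertex set `V`, edge set `E` and period lattice `L`
(which is assumed free of finite rank wherever it matters). -/
structure PeriodicGraph (L V E : Type*) [AddCommGroup L] [AddAction L V] [AddAction L E]
    extends WGraph V E where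
  free_V : ∀ (u : L) (x : V), u +ᵥ x = x → u = 0
  free_E : ∀ (u : L) (e : E), u +ᵥ e = e → u = 0
  finite_V : Finite (AddAction.orbitRel.Quotient L V)
  finite_E : Finite (AddAction.orbitRel.Quotient L E)
  s_vadd : ∀ (u : L) (e : E), s (u +ᵥ e) = u +ᵥ s e
  t_vadd : ∀ (u : L) (e : E), t (u +ᵥ e) = u +ᵥ t e
  w_vadd : ∀ (u : L) (e : E), w (u +ᵥ e) = w e

/-- The class of `x` modulo `L`. -/
def orbitClass (L : Type*) {X : Type*} [AddCommGroup L] [AddAction L X] (x : X) :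
    AddAction.orbitRel.Quotient L X :=
  Quotient.mk (AddAction.orbitRel L X) x

theorem orbitClass_eq_iff {L X : Type*} [AddCommGroup L] [AddAction L X] {x y : X} :
    orbitClass L x = orbitClass L y ↔ ∃ u : L, u +ᵥ y = x := by
  unfold orbitClass
  rw [Quotient.eq]
  exact Iff.rfl

namespace PeriodicGraph

variable {L V E : Type*} [AddCommGroup L] [AddAction L V] [AddAction L E]
variable (Γ : PeriodicGraph L V E)

/-- The quotient graph `Γ / L`. -/
def quot : WGraph (AddAction.orbitRel.Quotient L V) (AddAction.orbitRel.Quotient L E) where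
  s := Quotient.lift (fun e => orbitClass L (Γ.s e)) (by
    rintro _ b ⟨u, rfl⟩
    exact orbitClass_eq_iff.2 ⟨u, (Γ.s_vadd u b).symm⟩)
  t := Quotient.lift (fun e => orbitClass L (Γ.t e)) (by
    rintro _ b ⟨u, rfl⟩
    exact orbitClass_eq_iff.2 ⟨u, (Γ.t_vadd u b).symm⟩)
  w := Quotient.lift Γ.w (by
    rintro _ b ⟨u, rfl⟩
    exact Γ.w_vadd u b)
  w_pos := by
    rintro ⟨e⟩
    exact Γ.w_pos e

/-- A periodic realization: an `L`-equivariant map `Φ : V → L_ℝ = ℝ ⊗ L`. -/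
def IsRealization (_Γ : PeriodicGraph L V E) (Φ : V → ℝ ⊗[ℤ] L) : Prop :=
  ∀ (u : L) (x : V), Φ (u +ᵥ x) = (1 : ℝ) ⊗ₜ[ℤ] u + Φ x

/-- A periodic realization exists: send `u + r` to `1 ⊗ u`, with `r` running through
representatives of the vertex classes. -/
theorem exists_isRealization : ∃ Φ : V → ℝ ⊗[ℤ] L, Γ.IsRealization Φ := by
  have h : ∀ x : V, ∃ u : L, u +ᵥ (orbitClass L x).out = x := fun x =>
    orbitClass_eq_iff.1 (Quotient.out_eq (orbitClass L x)).symm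
  choose c hc using h
  refine ⟨fun x => (1 : ℝ) ⊗ₜ[ℤ] c x, fun u x => ?_⟩
  have hcl : orbitClass L (u +ᵥ x) = orbitClass L x := orbitClass_eq_iff.2 ⟨u, rfl⟩
  have h1 := hc (u +ᵥ x)
  rw [hcl] at h1
  have h2 : (u + c x) +ᵥ (orbitClass L x).out = u +ᵥ x := by rw [add_vadd, hc x]
  have h3 : c (u +ᵥ x) = u + c x := by
    have h4 : (-(c (u +ᵥ x)) + (u + c x)) +ᵥ (orbitClass L x).out = (orbitClass L x).out := by
      rw [add_vadd, h2]
      exact (congrArg (fun z => -(c (u +ᵥ x)) +ᵥ z) h1).symm.trans (neg_vadd_vadd _ _)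
    have h5 := Γ.free_V _ _ h4
    rw [neg_add_eq_zero] at h5
    exact h5
  simp only [h3, TensorProduct.tmul_add]

/-- `μ_Φ` on an edge of `Γ / L`: the vector `Φ(t(e)) - Φ(s(e))` for any representative `e`. -/
noncomputable def edgeVec {Φ : V → ℝ ⊗[ℤ] L} (hΦ : Γ.IsRealization Φ) :
    AddAction.orbitRel.Quotient L E → ℝ ⊗[ℤ] L :=
  Quotient.lift (fun e => Φ (Γ.t e) - Φ (Γ.s e)) (by
    rintro _ b ⟨u, rfl⟩
    simp only [Γ.t_vadd, Γ.s_vadd, hΦ u]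
    abel)

/-- `μ_Φ(⟨q⟩)` for a sequence `q` of edges of `Γ / L`. -/
noncomputable def muRealization {Φ : V → ℝ ⊗[ℤ] L} (hΦ : Γ.IsRealization Φ)
    (q : List (AddAction.orbitRel.Quotient L E)) : ℝ ⊗[ℤ] L :=
  (q.map (Γ.edgeVec hΦ)).sum

/-- `μ(⟨q⟩)` for a closed walk `q` in `Γ / L`, as an element of `L_ℝ`. It is computed from some
periodic realization; by `muRealization_eq_mu` every realization gives the same value, and by
`mu_eq_tmul` the value is the translation `t(p) - s(p) ∈ L` of any lift `p` of `q`. -/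
noncomputable def mu (q : List (AddAction.orbitRel.Quotient L E)) : ℝ ⊗[ℤ] L :=
  Γ.muRealization Γ.exists_isRealization.choose_spec q

theorem muRealization_map {Φ : V → ℝ ⊗[ℤ] L} (hΦ : Γ.IsRealization Φ) (p : List E) (x y : V)
    (h : Γ.IsWalk x p y) : Γ.muRealization hΦ (p.map (orbitClass L)) = Φ y - Φ x := by
  induction p generalizing x with
  | nil =>
    obtain rfl : x = y := h
    simp [muRealization]
  | cons e p ih =>
    obtain ⟨rfl, h⟩ := h
    have := ih _ h
    simp only [muRealization, List.map_cons, List.sum_cons] at this ⊢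
    rw [this]
    change Φ (Γ.t e) - Φ (Γ.s e) + _ = _
    abel

theorem mu_eq_tmul (p : List E) (x : V) (u : L) (h : Γ.IsWalk x p (u +ᵥ x)) :
    Γ.mu (p.map (orbitClass L)) = (1 : ℝ) ⊗ₜ[ℤ] u := by
  rw [mu, Γ.muRealization_map _ _ _ _ h, Γ.exists_isRealization.choose_spec u x]
  abel

theorem exists_lift (q : List (AddAction.orbitRel.Quotient L E)) (x : V)
    (z : AddAction.orbitRel.Quotient L V) (h : Γ.quot.IsWalk (orbitClass L x) q z) :
    ∃ p y, Γ.IsWalk x p y ∧ p.map (orbitClass L) = q ∧ orbitClass L y = z := by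
  induction q generalizing x with
  | nil => exact ⟨[], x, rfl, rfl, h⟩
  | cons e q ih =>
    obtain ⟨e, rfl⟩ := Quotient.exists_rep e
    obtain ⟨h1, h⟩ := h
    obtain ⟨u, hu⟩ := orbitClass_eq_iff.1 (show orbitClass L x = orbitClass L (Γ.s e) from h1.symm)
    have h2 : orbitClass L (u +ᵥ e) = orbitClass L e := orbitClass_eq_iff.2 ⟨u, rfl⟩
    have h3 : orbitClass L (Γ.t (u +ᵥ e)) = orbitClass L (Γ.t e) := by
      rw [Γ.t_vadd]; exact orbitClass_eq_iff.2 ⟨u, rfl⟩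
    obtain ⟨p, y, hp, rfl, hy⟩ := ih (Γ.t (u +ᵥ e)) (by rw [h3]; exact h)
    exact ⟨(u +ᵥ e) :: p, y, ⟨by rw [Γ.s_vadd, hu], hp⟩, by rw [List.map_cons, h2]; rfl, hy⟩

theorem muRealization_eq_mu {Φ : V → ℝ ⊗[ℤ] L} (hΦ : Γ.IsRealization Φ)
    (q : List (AddAction.orbitRel.Quotient L E)) (z : AddAction.orbitRel.Quotient L V)
    (h : Γ.quot.IsWalk z q z) : Γ.muRealization hΦ q = Γ.mu q := by
  obtain ⟨x, rfl⟩ := Quotient.exists_rep z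
  obtain ⟨p, y, hp, rfl, hy⟩ := Γ.exists_lift q x _ h
  obtain ⟨u, rfl⟩ := orbitClass_eq_iff.1 (show orbitClass L y = orbitClass L x from hy)
  rw [Γ.mu_eq_tmul p x u hp, Γ.muRealization_map hΦ p x _ hp, hΦ u x]
  abel

/-- The normalization map `ν(q) = μ(⟨q⟩) / w(q)`. -/
noncomputable def nu (q : List (AddAction.orbitRel.Quotient L E)) : ℝ ⊗[ℤ] L :=
  (Γ.quot.weight q : ℝ)⁻¹ • Γ.mu q

/-- The growth polytope `conv (ν(Cyc) ∪ {0})`. -/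
def growthPolytope : Set (ℝ ⊗[ℤ] L) :=
  convexHull ℝ (Γ.nu '' {q | Γ.quot.IsCycle q} ∪ {0})

theorem finite_cycles : {q | Γ.quot.IsCycle q}.Finite := by
  have := Γ.finite_V
  have := Γ.finite_E
  have := Fintype.ofFinite (AddAction.orbitRel.Quotient L V)
  refine (List.finite_length_le (AddAction.orbitRel.Quotient L E)
    (Fintype.card (AddAction.orbitRel.Quotient L V))).subset fun q hq => ?_
  have h := hq.2.2.length_le_card
  rwa [List.length_map] at h

theorem finite_vertices : ((Γ.growthPolytope).extremePoints ℝ \ {0}).Finite :=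
  (((Γ.finite_cycles.image Γ.nu).union (Set.finite_singleton 0)).subset
    extremePoints_convexHull_subset).sdiff

/-- The nonzero vertices of the growth polytope. -/
noncomputable def nonzeroVertices : Finset (ℝ ⊗[ℤ] L) := Γ.finite_vertices.toFinset

/-- `y` is `P`-initial: each nonzero vertex of the growth polytope is `ν` of a cycle through the
class of `y`. -/
def PInitial (y : V) : Prop :=
  ∀ v ∈ Γ.nonzeroVertices,
    ∃ q, Γ.quot.IsCycle q ∧ Γ.nu q = v ∧ orbitClass L y ∈ Γ.quot.supp q

theorem finite_out (x : V) : {e | Γ.s e = x}.Finite := by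
  have := Γ.finite_E
  refine Set.Finite.of_finite_image (f := orbitClass L) (Set.toFinite _) ?_
  intro a ha b hb hab
  obtain ⟨u, rfl⟩ := orbitClass_eq_iff.1 hab
  simp only [Set.mem_ofPred_eq, Γ.s_vadd] at ha hb
  rw [hb] at ha
  rw [Γ.free_V u x ha, zero_vadd]

theorem finite_walk_ends (n : ℕ) (x : V) :
    {y | ∃ p, Γ.IsWalk x p y ∧ p.length ≤ n}.Finite := by
  induction n generalizing x with
  | zero =>
    refine (Set.finite_singleton x).subset ?_
    rintro y ⟨p, hp, hl⟩
    obtain rfl := List.length_eq_zero_iff.1 (Nat.le_zero.1 hl)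
    exact Eq.symm hp
  | succ n ih =>
    refine ((Set.finite_singleton x).union
      ((Γ.finite_out x).biUnion fun e _ => ih (Γ.t e))).subset ?_
    rintro y ⟨_ | ⟨e, p⟩, hp, hl⟩
    · exact Or.inl (Eq.symm hp)
    · exact Or.inr (Set.mem_biUnion (x := e) hp.1 ⟨p, hp.2, Nat.le_of_succ_le_succ hl⟩)

theorem finite_sphere (x₀ : V) (i : ℕ) : (Γ.sphere x₀ i).Finite := by
  refine (Γ.finite_walk_ends i x₀).subset fun y hy => ?_
  have h1 : Γ.dist x₀ y < (i + 1 : ℕ) := by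
    rw [show Γ.dist x₀ y = i from hy]
    exact_mod_cast Nat.lt_succ_self i
  simp only [WGraph.dist, iInf_lt_iff] at h1
  obtain ⟨p, hp, hlt⟩ := h1
  refine ⟨p, hp, ?_⟩
  have h2 : Γ.weight p < i + 1 := by exact_mod_cast hlt
  have h3 : p.length ≤ Γ.weight p := by
    have := List.length_le_sum_of_one_le (p.map Γ.w) (by
      intro a ha
      obtain ⟨e, _, rfl⟩ := List.mem_map.1 ha
      exact Γ.w_pos e)
    rwa [List.length_map] at this
  omega

end PeriodicGraph

/-- `f` is a quasi-polynomial with `N` constituents `Q₀, …, Q_{N-1}`. -/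
def IsQuasiPolynomial (f : ℤ → ℂ) (N : ℕ) : Prop :=
  0 < N ∧ ∃ Q : Fin N → Polynomial ℂ, ∀ (n : ℤ) (i : Fin N),
    n ≡ (i : ℕ) [ZMOD N] → f n = (Q i).eval (n : ℂ)

/-- `N` is a quasi-period of `g`: `g` agrees with a quasi-polynomial with `N` constituents at all
sufficiently large integers. -/
def IsQuasiPeriod (g : ℕ → ℂ) (N : ℕ) : Prop :=
  ∃ f : ℤ → ℂ, IsQuasiPolynomial f N ∧ ∃ M : ℕ, ∀ n : ℕ, M < n → g n = f n

/-! ### A combinatorial Hilbert–Serre theorem for graded sets with translations. -/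

section HilbertSeries

variable {A X ι : Type*} [AddCommGroup A] [AddAction A X]

/-! Let B be the set of pairs (y, i) with d(x₀, y) ≤ i, inside V × ℤ with its action of L × ℤ. A
cycle q_v through the class of x₀ lifts to a walk from x₀ to μ(q_v) + x₀, and prefixing this walk
shows that B is stable under (μ(q_v), w(q_v)). It is also stable under (0, 1). So B behaves like a
graded module over a polynomial ring with one variable for each nonzero vertex and one extra
variable of degree 1.

The point is that this module is finitely generated (`exists_descent`). If (y, i) has large degree,
then either i exceeds the weight of a walk to y and (0, 1) can be subtracted, or a long walk to y
contains some quotient cycle q many times. Since ν(q) lies in the convex hull of 0 and the nonzero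
vertices, a multiple of (μ(q), w(q)) lies in the monoid of generators (`exists_nsmul_mem_closure`, a
rationality argument). Cutting out that many copies of q stays in B, so (y, i) is a generator plus
an element of B.

Hilbert–Serre (`exists_hilbertSeries_mul_prod`) then makes the series of B rational, with a factor 1
- t^w for each generator. The factor 1 - t coming from (0, 1) turns balls into spheres, leaving the
stated denominator. This denominator divides a power of 1 - t^N for any common multiple N of the
weights, which gives the quasi-period. -/

/-- `y` is obtained from `x` by translations by the `g s`, `s ∈ S`. -/
def Reaches (g : ι → A) (S : Finset ι) (x y : X) : Prop :=
  ∃ a : ι → ℕ, (∑ s ∈ S, a s • g s) +ᵥ x = y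

theorem Reaches.refl (g : ι → A) (S : Finset ι) (x : X) : Reaches g S x x :=
  ⟨0, by simp⟩

theorem Reaches.trans {g : ι → A} {S : Finset ι} {x y z : X} (h₁ : Reaches g S x y)
    (h₂ : Reaches g S y z) : Reaches g S x z := by
  obtain ⟨a, rfl⟩ := h₁
  obtain ⟨b, rfl⟩ := h₂
  refine ⟨b + a, ?_⟩
  simp only [Pi.add_apply, add_smul, Finset.sum_add_distrib, add_vadd]

theorem Reaches.vadd {g : ι → A} {S : Finset ι} {x y : X} (h : Reaches g S x y) (u : A) :
    Reaches g S (u +ᵥ x) (u +ᵥ y) := by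
  obtain ⟨a, rfl⟩ := h
  exact ⟨a, by rw [vadd_vadd, vadd_vadd, add_comm]⟩

theorem Reaches.step {g : ι → A} {S : Finset ι} {s : ι} (hs : s ∈ S) (x : X) :
    Reaches g S x (g s +ᵥ x) := by
  classical
  refine ⟨Pi.single s 1, ?_⟩
  rw [Finset.sum_eq_single_of_mem s hs fun b _ hb => by simp [hb]]
  simp

theorem Reaches.mono {g : ι → A} {S S' : Finset ι} (hS : S ⊆ S') {x y : X}
    (h : Reaches g S x y) : Reaches g S' x y := by
  classical
  obtain ⟨a, rfl⟩ := h
  refine ⟨fun s => if s ∈ S then a s else 0, ?_⟩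
  simp only [ite_smul, zero_smul]
  rw [← Finset.sum_filter, Finset.filter_mem_eq_inter, Finset.inter_eq_right.2 hS]

/-- If the coefficient of `h` is positive, one translation by `g h` can be made the last one,
because translations commute. -/
theorem Reaches.insert_cases [DecidableEq ι] {g : ι → A} {S : Finset ι} {h : ι} {x y : X}
    (hh : h ∉ S) (hxy : Reaches g (insert h S) x y) :
    Reaches g S x y ∨ ∃ z, Reaches g (insert h S) x z ∧ g h +ᵥ z = y := by
  obtain ⟨a, rfl⟩ := hxy
  rcases Nat.eq_zero_or_pos (a h) with h0 | h0
  · exact Or.inl ⟨a, by rw [Finset.sum_insert hh, h0, zero_smul, zero_add]⟩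
  · refine Or.inr ⟨(∑ s ∈ insert h S, (a s - (Pi.single h 1 : ι → ℕ) s) • g s) +ᵥ x, ⟨_, rfl⟩, ?_⟩
    rw [vadd_vadd, Finset.sum_insert hh, Finset.sum_insert hh, ← add_assoc]
    congr 2
    · obtain ⟨k, hk⟩ := Nat.exists_eq_succ_of_ne_zero h0.ne'
      simp [hk, add_smul, add_comm]
    · refine Finset.sum_congr rfl fun s hs => ?_
      have : s ≠ h := fun e => hh (e ▸ hs)
      simp [this]

/-- Order convexity with respect to `Reaches`. -/
def ReachConvex (g : ι → A) (S : Finset ι) (T : Set X) : Prop :=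
  ∀ ⦃x y z⦄, x ∈ T → z ∈ T → Reaches g S x y → Reaches g S y z → y ∈ T

/-- The generating function of a graded set. -/
noncomputable def hilbertSeries (deg : X → ℤ) (T : Set X) : PowerSeries ℤ :=
  PowerSeries.mk fun i => ({x ∈ T | deg x = i}.ncard : ℤ)

theorem hilbertSeries_of_finite (deg : X → ℤ) {T : Set X} (hT : T.Finite) :
    ∃ Q : Polynomial ℤ, hilbertSeries deg T = Q := by
  obtain ⟨B, hB⟩ := (hT.image fun x => (deg x).toNat).bddAbove
  refine ⟨(hilbertSeries deg T).trunc (B + 1), ?_⟩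
  ext i
  rw [Polynomial.coeff_coe, PowerSeries.coeff_trunc]
  split_ifs with h
  · rfl
  · rw [hilbertSeries, PowerSeries.coeff_mk]
    have : {x ∈ T | deg x = i} = ∅ := by
      ext x
      simp only [Set.mem_ofPred_eq, Set.mem_empty_iff_false, iff_false, not_and]
      intro hx hd
      have := hB (Set.mem_image_of_mem _ hx)
      simp only [hd] at this
      omega
    rw [this]
    simp

/-- The exact sequence for multiplication by a translation, on the level of series. -/
theorem hilbertSeries_mul_one_sub {deg : X → ℤ} {T : Set X} {u : A} {d : ℕ}
    (hdeg : ∀ x, deg (u +ᵥ x) = deg x + d) (hnn : ∀ x ∈ T, 0 ≤ deg x)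
    (hfin : ∀ i, {x ∈ T | deg x = i}.Finite) :
    hilbertSeries deg T * (1 - PowerSeries.X ^ d) =
      hilbertSeries deg {x ∈ T | -u +ᵥ x ∉ T} -
        PowerSeries.X ^ d * hilbertSeries deg {x ∈ T | u +ᵥ x ∉ T} := by
  have key : ∀ i : ℤ, ({x ∈ T | deg x = i}.ncard : ℤ) - {x ∈ T | deg x = i - d}.ncard =
      ({x ∈ {x ∈ T | -u +ᵥ x ∉ T} | deg x = i}.ncard : ℤ) -
        {x ∈ {x ∈ T | u +ᵥ x ∉ T} | deg x = i - d}.ncard := by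
    intro i
    have e1 : {x ∈ T | deg x = i}.ncard = {x ∈ {x ∈ T | -u +ᵥ x ∉ T} | deg x = i}.ncard +
        {x ∈ T | -u +ᵥ x ∈ T ∧ deg x = i}.ncard := by
      rw [← Set.ncard_union_eq
        (by rw [Set.disjoint_left]; rintro x ⟨⟨_, h⟩, _⟩ ⟨_, h', _⟩; exact h h')
        ((hfin i).subset fun x hx => ⟨hx.1.1, hx.2⟩)
        ((hfin i).subset fun x hx => ⟨hx.1, hx.2.2⟩)]
      congr 1; ext x; simp only [Set.mem_union, Set.mem_ofPred_eq]; tauto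
    have e2 : {x ∈ T | deg x = i - d}.ncard =
        {x ∈ {x ∈ T | u +ᵥ x ∉ T} | deg x = i - d}.ncard +
        {x ∈ T | u +ᵥ x ∈ T ∧ deg x = i - d}.ncard := by
      rw [← Set.ncard_union_eq
        (by rw [Set.disjoint_left]; rintro x ⟨⟨_, h⟩, _⟩ ⟨_, h', _⟩; exact h h')
        ((hfin (i - d)).subset fun x hx => ⟨hx.1.1, hx.2⟩)
        ((hfin (i - d)).subset fun x hx => ⟨hx.1, hx.2.2⟩)]
      congr 1; ext x; simp only [Set.mem_union, Set.mem_ofPred_eq]; tauto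
    -- Translation by `u` matches the elements of degree `i - d` that stay in `T` with those of
    -- degree `i` that come from `T`; only kernel and cokernel survive in the difference.
    have e3 : {x ∈ T | -u +ᵥ x ∈ T ∧ deg x = i}.ncard =
        {x ∈ T | u +ᵥ x ∈ T ∧ deg x = i - d}.ncard := by
      rw [← Set.ncard_image_of_injective {x ∈ T | u +ᵥ x ∈ T ∧ deg x = i - d}
        (AddAction.injective u)]
      congr 1
      ext x
      simp only [Set.mem_ofPred_eq, Set.mem_image]
      constructor
      · rintro ⟨h1, h2, h3⟩
        have h4 := hdeg (-u +ᵥ x)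
        rw [vadd_neg_vadd] at h4
        exact ⟨-u +ᵥ x, ⟨h2, by rwa [vadd_neg_vadd], by omega⟩, vadd_neg_vadd _ _⟩
      · rintro ⟨y, ⟨h1, h2, h3⟩, rfl⟩
        exact ⟨h2, by rwa [neg_vadd_vadd], by rw [hdeg]; omega⟩
    rw [e1, e2, e3]
    push_cast
    ring
  ext i
  rw [mul_sub, mul_one, mul_comm, map_sub, map_sub, PowerSeries.coeff_X_pow_mul',
    PowerSeries.coeff_X_pow_mul']
  simp only [hilbertSeries, PowerSeries.coeff_mk]
  have := key i
  split_ifs with h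
  · rwa [← Nat.cast_sub h] at this
  · have h0 : {x ∈ T | deg x = (i : ℤ) - d} = ∅ := by
      ext x
      simp only [Set.mem_ofPred_eq, Set.mem_empty_iff_false, iff_false, not_and]
      intro hx hd
      have := hnn x hx
      omega
    have h1 : {x ∈ {x ∈ T | u +ᵥ x ∉ T} | deg x = (i : ℤ) - d} = ∅ :=
      Set.eq_empty_of_forall_notMem fun x hx =>
        Set.notMem_empty x (h0 ▸ (⟨hx.1.1, hx.2⟩ : x ∈ {x ∈ T | deg x = (i : ℤ) - d}))
    rwa [h0, h1, Set.ncard_empty] at this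

/-- A Hilbert–Serre theorem for graded sets: the generating function of a convex, well-quasi-ordered
set of positive degree is rational. -/
theorem exists_hilbertSeries_mul_prod (g : ι → A) (d : ι → ℕ) (deg : X → ℤ)
    (hdeg : ∀ s x, deg (g s +ᵥ x) = deg x + d s) (S : Finset ι) (T : Set X)
    (hnn : ∀ x ∈ T, 0 ≤ deg x) (hfin : ∀ i, {x ∈ T | deg x = i}.Finite)
    (hconv : ReachConvex g S T) (hpwo : T.PartiallyWellOrderedOn (Reaches g S)) :
    ∃ Q : Polynomial ℤ,
      hilbertSeries deg T * ∏ s ∈ S, (1 - PowerSeries.X ^ d s) = (Q : PowerSeries ℤ) := by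
  classical
  induction S using Finset.induction_on generalizing T with
  | empty =>
    have hT : T.Finite := by
      -- With no translations available, `Reaches` is equality, so `T` is an antichain.
      refine IsAntichain.finite_of_partiallyWellOrderedOn (r := Reaches g ∅) ?_ hpwo
      rintro x _ y _ hxy ⟨a, rfl⟩
      simp at hxy
    simpa using hilbertSeries_of_finite deg hT
  | insert h S hh ih =>
    have hsub : S ⊆ insert h S := Finset.subset_insert _ _
    have hmem : h ∈ insert h S := Finset.mem_insert_self _ _
    -- The cokernel of translation by `g h`. It need not be stable, but it is again convex. In a
    -- comparable pair the step `g h` cannot occur: the larger element would be `g h` plus an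
    -- element lying in `T` by convexity.
    obtain ⟨Q₁, hQ₁⟩ := ih {x ∈ T | -g h +ᵥ x ∉ T} (fun x hx => hnn x hx.1)
      (fun i => (hfin i).subset fun x hx => ⟨hx.1.1, hx.2⟩)
      (by
        intro x y z hx hz hxy hyz
        have hxy' := hxy.mono hsub
        have hyz' := hyz.mono hsub
        have hy := hconv hx.1 hz.1 hxy' hyz'
        refine ⟨hy, fun hy' => hz.2 (hconv hy' hz.1 (hyz'.vadd _) ?_)⟩
        simpa using Reaches.step (g := g) hmem (-g h +ᵥ z))
      (by
        rw [Set.partiallyWellOrderedOn_iff_exists_lt]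
        intro f hf
        obtain ⟨m, n, hmn, hr⟩ := hpwo.exists_lt fun n => (hf n).1
        refine ⟨m, n, hmn, (hr.insert_cases hh).resolve_right ?_⟩
        rintro ⟨z, hz, hz'⟩
        refine (hf n).2 ?_
        rw [← hz', neg_vadd_vadd]
        exact hconv (hf m).1 (hf n).1 hz (hz' ▸ Reaches.step hmem z))
    -- The kernel. If the step `g h` occurred in a comparable pair, then `g h` plus the smaller
    -- element would lie between the two, hence in `T`.
    obtain ⟨Q₂, hQ₂⟩ := ih {x ∈ T | g h +ᵥ x ∉ T} (fun x hx => hnn x hx.1)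
      (fun i => (hfin i).subset fun x hx => ⟨hx.1.1, hx.2⟩)
      (by
        intro x y z hx hz hxy hyz
        have hxy' := hxy.mono hsub
        have hyz' := hyz.mono hsub
        have hy := hconv hx.1 hz.1 hxy' hyz'
        exact ⟨hy, fun hy' => hx.2 (hconv hx.1 hy' (Reaches.step hmem x) (hxy'.vadd _))⟩)
      (by
        rw [Set.partiallyWellOrderedOn_iff_exists_lt]
        intro f hf
        obtain ⟨m, n, hmn, hr⟩ := hpwo.exists_lt fun n => (hf n).1
        refine ⟨m, n, hmn, (hr.insert_cases hh).resolve_right ?_⟩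
        rintro ⟨z, hz, hz'⟩
        exact (hf m).2 (hconv (hf m).1 (hf n).1 (Reaches.step hmem _) (hz' ▸ hz.vadd _)))
    refine ⟨Q₁ - Polynomial.X ^ d h * Q₂, ?_⟩
    rw [Finset.prod_insert hh, ← mul_assoc,
      hilbertSeries_mul_one_sub (hdeg h) hnn hfin, sub_mul, hQ₁, mul_assoc, hQ₂]
    simp

/-- A set stable under positive translations is well-quasi-ordered if all its elements of large
degree are translates of other elements. -/
theorem partiallyWellOrderedOn_reaches (g : ι → A) (d : ι → ℕ) (deg : X → ℤ)
    (hdeg : ∀ s x, deg (g s +ᵥ x) = deg x + d s) (S : Finset ι) (hd : ∀ s ∈ S, 0 < d s)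
    (T : Set X) (hnn : ∀ x ∈ T, 0 ≤ deg x) (hfin : ∀ i, {x ∈ T | deg x = i}.Finite) (K : ℕ)
    (hK : ∀ x ∈ T, (K : ℤ) ≤ deg x → ∃ s ∈ S, ∃ y ∈ T, g s +ᵥ y = x) :
    T.PartiallyWellOrderedOn (Reaches g S) := by
  have hF : {x ∈ T | deg x < K}.Finite := by
    refine ((Set.finite_Ico (0 : ℤ) K).biUnion fun i _ => hfin i).subset ?_
    intro x hx
    exact Set.mem_biUnion (x := deg x) ⟨hnn x hx.1, hx.2⟩ ⟨hx.1, rfl⟩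
  have hgen : ∀ n : ℕ, ∀ x ∈ T, deg x < n → ∃ y ∈ {x ∈ T | deg x < K}, Reaches g S y x := by
    intro n
    induction n with
    | zero => exact fun x hx h => absurd (hnn x hx) (by simpa using h)
    | succ n ih =>
      intro x hx hxn
      by_cases h : deg x < K
      · exact ⟨x, ⟨hx, h⟩, .refl ..⟩
      · obtain ⟨s, hs, y, hy, rfl⟩ := hK x hx (not_lt.1 h)
        have h1 := hd s hs
        rw [hdeg] at hxn
        obtain ⟨z, hz, hzy⟩ := ih y hy (by push_cast at hxn; omega)
        exact ⟨z, hz, hzy.trans (.step hs y)⟩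
  -- Dickson's lemma for exponent vectors, times the finite set of generators; `T` lies in the
  -- monotone image of this product.
  have hprod : (Set.univ.pi (fun _ : S => (Set.univ : Set ℕ)) ×ˢ
      {x ∈ T | deg x < K}).PartiallyWellOrderedOn
        fun p q : (S → ℕ) × X => (∀ s, p.1 s ≤ q.1 s) ∧ p.2 = q.2 :=
    (Set.PartiallyWellOrderedOn.pi fun _ => Set.IsWF.isPWO (Set.IsWF.of_wellFoundedLT _)).prod
      hF.partiallyWellOrderedOn
  refine (hprod.image_of_monotone_on (f := fun p => (∑ s : S, p.1 s • g s) +ᵥ p.2)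
    (r' := Reaches g S) ?_).mono ?_
  · rintro ⟨a, x⟩ - ⟨b, y⟩ - ⟨hab, hxy⟩
    dsimp only at hab hxy ⊢
    subst hxy
    classical
    refine ⟨fun s => if hs : s ∈ S then b ⟨s, hs⟩ - a ⟨s, hs⟩ else 0, ?_⟩
    rw [← Finset.sum_coe_sort S, vadd_vadd, ← Finset.sum_add_distrib]
    congr 1
    refine Finset.sum_congr rfl fun s _ => ?_
    dsimp only
    rw [dif_pos s.2, ← add_smul, Nat.sub_add_cancel (hab s)]
  · intro x hx
    obtain ⟨y, hy, a, rfl⟩ := hgen ((deg x).toNat + 1) x hx (by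
      have := Int.self_le_toNat (deg x)
      push_cast
      omega)
    refine ⟨(fun s => a s, y), ⟨fun _ _ => trivial, hy⟩, ?_⟩
    dsimp only
    rw [Finset.sum_coe_sort S fun s => a s • g s]

end HilbertSeries

/-! ### From rational generating functions to quasi-periods. -/

section QuasiPeriod

/-- The power series formed by the coefficients in the residue class `r` modulo `N`. -/
noncomputable def PowerSeries.multisection (N r : ℕ) (F : PowerSeries ℂ) : PowerSeries ℂ :=
  PowerSeries.mk fun m => PowerSeries.coeff (N * m + r) F

/-- Multiplication by `X ^ N` preserves residue classes modulo `N` and shifts the index within each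
class by one. -/
theorem PowerSeries.multisection_mul_one_sub {N r : ℕ} (hr : r < N) (F : PowerSeries ℂ) :
    PowerSeries.multisection N r (F * (1 - PowerSeries.X ^ N)) =
      PowerSeries.multisection N r F * (1 - PowerSeries.X) := by
  ext m
  rw [mul_sub, mul_sub, mul_one, mul_one, map_sub]
  simp only [PowerSeries.multisection, PowerSeries.coeff_mk, map_sub,
    PowerSeries.coeff_mul_X_pow']
  congr 1
  cases m with
  | zero => simp [hr]
  | succ m =>
    rw [PowerSeries.coeff_succ_mul_X, PowerSeries.coeff_mk, if_pos (by nlinarith)]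
    congr 2
    rw [Nat.mul_succ]
    omega

theorem PowerSeries.multisection_mul_one_sub_pow {N r : ℕ} (hr : r < N) (k : ℕ)
    (F : PowerSeries ℂ) :
    PowerSeries.multisection N r (F * (1 - PowerSeries.X ^ N) ^ k) =
      PowerSeries.multisection N r F * (1 - PowerSeries.X) ^ k := by
  induction k with
  | zero => simp
  | succ k ih =>
    rw [pow_succ, ← mul_assoc, multisection_mul_one_sub hr, ih, pow_succ, mul_assoc]

theorem PowerSeries.exists_multisection_coe {N : ℕ} (hN : 0 < N) (r : ℕ) (Q : Polynomial ℂ) :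
    ∃ P : Polynomial ℂ, PowerSeries.multisection N r Q = P := by
  refine ⟨(PowerSeries.multisection N r Q).trunc (Q.natDegree + 1), ?_⟩
  ext m
  rw [Polynomial.coeff_coe, PowerSeries.coeff_trunc]
  split_ifs with h
  · rfl
  · rw [multisection, PowerSeries.coeff_mk, Polynomial.coeff_coe]
    apply Polynomial.coeff_eq_zero_of_natDegree_lt
    nlinarith

/-- A sequence whose generating function is a polynomial divided by a power of `1 - X ^ N` has
quasi-period `N`. -/
theorem IsQuasiPeriod.of_mul_one_sub_pow {a : ℕ → ℂ} {N k : ℕ} (hN : 0 < N) {Q : Polynomial ℂ}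
    (h : PowerSeries.mk a * (1 - PowerSeries.X ^ N) ^ k = (Q : PowerSeries ℂ)) : IsQuasiPeriod a N := by
  have hsec : ∀ r : Fin N, ∃ (P : Polynomial ℂ) (M : ℕ), ∀ m : ℕ, M < m →
      a (N * m + r) = P.eval (m : ℂ) := by
    intro r
    obtain ⟨P, hP⟩ := PowerSeries.exists_multisection_coe hN r Q
    rw [← h, PowerSeries.multisection_mul_one_sub_pow r.2] at hP
    refine ⟨P.hilbertPoly k, P.natDegree, fun m hm => ?_⟩
    rw [← Polynomial.coeff_mul_invOneSubPow_eq_hilbertPoly_eval k hm, ← hP, mul_assoc,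
      ← PowerSeries.invOneSubPow_inv_eq_one_sub_pow, Units.inv_val, mul_one]
    simp [PowerSeries.multisection]
  choose P M hM using hsec
  -- The constituents are polynomials in `n / N`, rewritten in terms of `n`. The threshold makes `n
  -- / N` exceed every `M r` at once.
  refine ⟨fun n => (P ⟨(n % N).toNat, ?_⟩).eval (((n : ℂ) - (n % N).toNat) / N),
    ⟨hN, fun r => (P r).comp (Polynomial.C (N : ℂ)⁻¹ * (Polynomial.X - Polynomial.C (r : ℂ))),
      ?_⟩, N * (∑ r, M r + 1), ?_⟩
  · have h1 := Int.emod_lt_of_pos n (Int.natCast_pos.2 hN)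
    have h2 := Int.emod_nonneg n (Int.natCast_pos.2 hN).ne'
    omega
  · intro n r hr
    have h1 : (n % N).toNat = r := by
      have : n % N = ((r : ℕ) : ℤ) % N := hr
      rw [this, Int.emod_eq_of_lt (by omega) (by exact_mod_cast r.2)]
      simp
    simp only [h1, Polynomial.eval_comp, Polynomial.eval_mul, Polynomial.eval_C,
      Polynomial.eval_sub, Polynomial.eval_X]
    rw [div_eq_inv_mul]
  · intro n hn
    have h1 : ((n : ℤ) % N).toNat = n % N := by
      rw [← Int.natCast_mod, Int.toNat_natCast]
    have h2 := hM ⟨n % N, Nat.mod_lt _ hN⟩ (n / N) (by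
      have h3 : M ⟨n % N, Nat.mod_lt _ hN⟩ ≤ ∑ r, M r :=
        Finset.single_le_sum (f := M) (fun _ _ => Nat.zero_le _) (Finset.mem_univ _)
      have h4 : ∑ r, M r + 1 ≤ n / N := by
        rw [Nat.le_div_iff_mul_le hN, mul_comm]
        exact hn.le
      omega)
    simp only [Nat.div_add_mod] at h2
    rw [h2]
    simp only [h1]
    congr 1
    have hN' : (N : ℂ) ≠ 0 := by exact_mod_cast hN.ne'
    rw [eq_div_iff hN', eq_sub_iff_add_eq, Int.cast_natCast]
    exact_mod_cast Nat.div_add_mod' n N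

theorem one_sub_X_pow_dvd {R : Type*} [CommRing R] {w N : ℕ} (h : w ∣ N) :
    (1 - Polynomial.X ^ w : Polynomial R) ∣ 1 - Polynomial.X ^ N := by
  obtain ⟨c, rfl⟩ := h
  rw [pow_mul]
  simpa using sub_dvd_pow_sub_pow (1 : Polynomial R) (Polynomial.X ^ w) c

/-- Each factor divides `1 - X ^ N`, so the denominator can be enlarged to `(1 - X ^ N) ^ S.card`.
-/
theorem IsQuasiPeriod.of_mul_prod {ι : Type*} {a : ℕ → ℕ} {N : ℕ} (hN : 0 < N) (S : Finset ι)
    (w : ι → ℕ) (hw : ∀ s ∈ S, w s ∣ N) {Q : Polynomial ℤ}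
    (h : PowerSeries.mk (fun i => (a i : ℤ)) * ∏ s ∈ S, (1 - PowerSeries.X ^ w s) =
      (Q : PowerSeries ℤ)) :
    IsQuasiPeriod (fun i => (a i : ℂ)) N := by
  have h1 : (∏ s ∈ S, (1 - Polynomial.X ^ w s) : Polynomial ℤ) ∣
      (1 - Polynomial.X ^ N) ^ S.card := by
    rw [← Finset.prod_const]
    exact Finset.prod_dvd_prod_of_dvd _ _ fun s hs => one_sub_X_pow_dvd (hw s hs)
  obtain ⟨R, hR⟩ := h1
  have hR' : (1 - PowerSeries.X ^ N : PowerSeries ℤ) ^ S.card =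
      (∏ s ∈ S, (1 - PowerSeries.X ^ w s)) * (R : PowerSeries ℤ) := by
    have := congrArg (Polynomial.coeToPowerSeries.ringHom (R := ℤ)) hR
    rw [map_mul, map_prod] at this
    simpa using this
  have h2 : PowerSeries.mk (fun i => (a i : ℤ)) * (1 - PowerSeries.X ^ N) ^ S.card =
      ((Q * R : Polynomial ℤ) : PowerSeries ℤ) := by
    rw [hR', ← mul_assoc, h, Polynomial.coe_mul]
  refine IsQuasiPeriod.of_mul_one_sub_pow (k := S.card)
    (Q := (Q * R).map (Int.castRingHom ℂ)) hN ?_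
  have := congrArg (PowerSeries.map (Int.castRingHom ℂ)) h2
  rw [map_mul, map_pow, map_sub, map_pow, PowerSeries.map_X, map_one,
    ← Polynomial.polynomial_map_coe] at this
  rw [← this]
  congr 1

end QuasiPeriod

/-! ### Rational points in convex hulls of rational points. -/

section RationalCombination

theorem convexHull_extremePoints_convexHull {F : Type*} [AddCommGroup F] [Module ℝ F]
    [FiniteDimensional ℝ F] {S : Set F} (hS : S.Finite) :
    convexHull ℝ ((convexHull ℝ S).extremePoints ℝ) = convexHull ℝ S := by
  -- `F` carries no topology, so Krein–Milman is applied in coordinates. The hull of the finitely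
  -- many extreme points is already closed.
  let e : F ≃ₗ[ℝ] (Fin (Module.finrank ℝ F) → ℝ) := (Module.finBasis ℝ F).equivFun
  have himg : ∀ U : Set F, e '' convexHull ℝ U = convexHull ℝ (e '' U) := fun U =>
    e.toLinearMap.image_convexHull U
  apply Set.image_injective.2 e.injective
  rw [himg, image_extremePoints, himg]
  have hfin : ((convexHull ℝ (e '' S)).extremePoints ℝ).Finite :=
    (hS.image e).subset extremePoints_convexHull_subset
  rw [← (hfin.isClosed_convexHull ℝ).closure_eq]
  exact closure_convexHull_extremePoints ((hS.image e).isCompact_convexHull ℝ) (convex_convexHull ..)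

theorem tmul_one_injective (L : Type*) [AddCommGroup L] [Module.Free ℤ L] :
    Function.Injective fun u : L => (1 : ℝ) ⊗ₜ[ℤ] u := by
  have h := Module.Flat.rTensor_preserves_injective_linearMap (M := L)
    (LinearMap.toSpanSingleton ℤ ℝ 1) (by
      intro a b hab
      simpa using hab)
  intro u v huv
  have h2 : (1 : ℤ) ⊗ₜ[ℤ] u = (1 : ℤ) ⊗ₜ[ℤ] v := h (by simpa using huv)
  simpa using congrArg (TensorProduct.lid ℤ L) h2

/-- The coefficients of a rational point with respect to affinely independent rational points are
rational. -/
theorem exists_rat_coeff {L ι : Type*} [AddCommGroup L] [Fintype ι] {z : ι → ℝ ⊗[ℤ] L}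
    (hz : AffineIndependent ℝ z) {c : ι → ℝ} (hc : ∑ i, c i = 1)
    {u : ι → L} {w : ι → ℚ} (hzu : ∀ i, z i = (w i : ℝ) ⊗ₜ[ℤ] u i) {u₀ : L} {w₀ : ℚ}
    (h : ∑ i, c i • z i = (w₀ : ℝ) ⊗ₜ[ℤ] u₀) :
    ∃ r : ι → ℚ, ∀ i, c i = r i := by
  -- A `ℚ`-linear retraction of `ℝ` onto `ℚ`. Applied to the first tensor factor, it fixes the
  -- rational points and replaces each `c i` by `π (c i)`; affine independence forces the two
  -- combinations to agree.
  obtain ⟨π, hπ⟩ := LinearMap.exists_leftInverse_of_injective (Algebra.linearMap ℚ ℝ)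
    (LinearMap.ker_eq_bot.2 (algebraMap ℚ ℝ).injective)
  have hπ' : ∀ r : ℚ, π (r : ℝ) = r := fun r => LinearMap.congr_fun hπ r
  have hπmul : ∀ (x : ℝ) (r : ℚ), π (x * r) = π x * r := by
    intro x r
    have := π.map_smul r x
    rw [Rat.smul_def, mul_comm] at this
    rw [this, smul_eq_mul, mul_comm]
  let ρ : ℝ →ₗ[ℤ] ℝ := ((Algebra.linearMap ℚ ℝ).comp π).restrictScalars ℤ
  have hρ : ∀ x, ρ x = (π x : ℝ) := fun x => rfl
  have h1 : ∑ i, (π (c i) : ℝ) • z i = (w₀ : ℝ) ⊗ₜ[ℤ] u₀ := by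
    have := congrArg (LinearMap.rTensor L ρ) h
    rw [map_sum, LinearMap.rTensor_tmul, hρ, hπ'] at this
    rw [← this]
    refine Finset.sum_congr rfl fun i _ => ?_
    rw [hzu, TensorProduct.smul_tmul', TensorProduct.smul_tmul', LinearMap.rTensor_tmul, hρ,
      smul_eq_mul, smul_eq_mul, hπmul]
    push_cast
    rfl
  have h2 : ∑ i, (π (c i) : ℝ) = 1 := by
    rw [← Rat.cast_sum, ← map_sum, hc]
    have := hπ' 1
    rw [Rat.cast_one] at this
    rw [this, Rat.cast_one]
  refine ⟨fun i => π (c i), fun i => ?_⟩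
  have h3 := affineIndependent_iff.1 hz Finset.univ (fun i => c i - (π (c i) : ℝ))
    (by rw [Finset.sum_sub_distrib, hc, h2, sub_self])
    (by simp only [sub_smul]; rw [Finset.sum_sub_distrib, h, h1, sub_self]) i (Finset.mem_univ i)
  exact sub_eq_zero.1 h3

theorem exists_common_denominator {ι : Type*} [Fintype ι] (r : ι → ℚ) (hr : ∀ i, 0 ≤ r i) :
    ∃ N : ℕ, 0 < N ∧ ∃ a : ι → ℕ, ∀ i, (N : ℚ) * r i = a i := by
  refine ⟨∏ i, (r i).den, Finset.prod_pos fun i _ => (r i).pos, ?_⟩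
  have : ∀ i, ∃ a : ℕ, ((∏ j, (r j).den : ℕ) : ℚ) * r i = a := by
    intro i
    obtain ⟨c, hc⟩ := Finset.dvd_prod_of_mem (fun j => (r j).den) (Finset.mem_univ i)
    refine ⟨c * (r i).num.toNat, ?_⟩
    have h1 : ((r i).num.toNat : ℚ) = (r i).num := by
      exact_mod_cast Int.toNat_of_nonneg (Rat.num_nonneg.2 (hr i))
    rw [hc]
    push_cast
    rw [h1, mul_comm ((r i).den : ℚ), mul_assoc, Rat.den_mul_eq_num]
  choose a ha using this
  exact ⟨a, ha⟩

/-- If `u / w` lies in the convex hull of the points `uₖ / wₖ`, then a positive multiple of `(u, w)`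
lies in the monoid generated by the `(uₖ, wₖ)`. -/
theorem exists_nsmul_mem_closure {L κ : Type*} [AddCommGroup L] [Module.Free ℤ L] (S : Set κ)
    (u : κ → L) (w : κ → ℕ) (hw : ∀ k ∈ S, 0 < w k) {u₀ : L} {w₀ : ℕ} (hw₀ : 0 < w₀)
    (h : (w₀ : ℝ)⁻¹ • (1 : ℝ) ⊗ₜ[ℤ] u₀ ∈
      convexHull ℝ ((fun k => (w k : ℝ)⁻¹ • (1 : ℝ) ⊗ₜ[ℤ] u k) '' S)) :
    ∃ N : ℕ, 0 < N ∧ N • (u₀, (w₀ : ℤ)) ∈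
      AddSubmonoid.closure ((fun k => (u k, (w k : ℤ))) '' S) := by
  -- Carathéodory: affinely independent points make the coefficients unique, hence rational.
  obtain ⟨ι, _, z, c, hz, hind, hpos, hsum, hcomb⟩ := eq_pos_convex_span_of_mem_convexHull h
  have hk : ∀ i, ∃ k ∈ S, (w k : ℝ)⁻¹ • (1 : ℝ) ⊗ₜ[ℤ] u k = z i := fun i => hz ⟨i, rfl⟩
  choose k hkS hkz using hk
  obtain ⟨r, hr⟩ := exists_rat_coeff hind hsum (u := fun i => u (k i))
    (w := fun i => (w (k i) : ℚ)⁻¹) (u₀ := u₀) (w₀ := (w₀ : ℚ)⁻¹)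
    (by
      intro i
      rw [← hkz, TensorProduct.smul_tmul']
      simp)
    (by
      rw [hcomb, TensorProduct.smul_tmul']
      simp)
  have hrpos : ∀ i, 0 ≤ r i := fun i => by
    have := (hpos i).le
    rw [hr i] at this
    exact_mod_cast this
  -- The numbers `w₀ * c i / w (k i)` are the coefficients of `(u₀, w₀)` in terms of the `(uₖ, wₖ)`;
  -- the second coordinate uses that the `c i` sum to 1.
  obtain ⟨N, hN, a, ha⟩ := exists_common_denominator (fun i => w₀ * r i / w (k i))
    (fun i => div_nonneg (mul_nonneg (Nat.cast_nonneg _) (hrpos i)) (Nat.cast_nonneg _))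
  have ha' : ∀ i, (a i : ℝ) = N * (w₀ * c i / w (k i)) := fun i => by
    rw [hr i]
    exact_mod_cast (ha i).symm
  have hw₀' : (w₀ : ℝ) ≠ 0 := by exact_mod_cast hw₀.ne'
  refine ⟨N, hN, ?_⟩
  have h1 : N • u₀ = ∑ i, a i • u (k i) := by
    apply tmul_one_injective L
    dsimp only
    rw [TensorProduct.tmul_sum]
    have h2 : (1 : ℝ) ⊗ₜ[ℤ] (N • u₀) = ((N : ℝ) * w₀) • ((w₀ : ℝ)⁻¹ • (1 : ℝ) ⊗ₜ[ℤ] u₀) := by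
      rw [smul_smul, mul_assoc, mul_inv_cancel₀ hw₀', mul_one, TensorProduct.tmul_smul,
        Nat.cast_smul_eq_nsmul]
    rw [h2, ← hcomb, Finset.smul_sum]
    refine Finset.sum_congr rfl fun i _ => ?_
    rw [← hkz, smul_smul, smul_smul, TensorProduct.tmul_smul, ← Nat.cast_smul_eq_nsmul ℝ, ha']
    congr 1
    ring
  have h2 : N • (w₀ : ℤ) = ∑ i, a i • (w (k i) : ℤ) := by
    have h3 : (N : ℝ) * w₀ = ∑ i, (a i : ℝ) * w (k i) := by
      rw [← mul_one ((N : ℝ) * w₀), ← hsum, Finset.mul_sum]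
      refine Finset.sum_congr rfl fun i _ => ?_
      have : (w (k i) : ℝ) ≠ 0 := by exact_mod_cast (hw _ (hkS i)).ne'
      rw [ha']
      field_simp
    simp only [nsmul_eq_mul]
    exact_mod_cast h3
  have h3 : N • (u₀, (w₀ : ℤ)) = ∑ i, a i • (u (k i), (w (k i) : ℤ)) := by
    ext
    · simpa [Prod.fst_sum] using h1
    · simpa [Prod.snd_sum] using h2
  rw [h3]
  exact sum_mem fun i _ => nsmul_mem (AddSubmonoid.subset_closure (Set.mem_image_of_mem _ (hkS i))) _

end RationalCombination

/-! ### Walks and cycles in a weighted graph. -/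

namespace WGraph

variable {V E : Type*} {Γ : WGraph V E}

theorem isWalk_append {x y : V} {p q : List E} :
    Γ.IsWalk x (p ++ q) y ↔ ∃ z, Γ.IsWalk x p z ∧ Γ.IsWalk z q y := by
  induction p generalizing x with
  | nil => simp [IsWalk]
  | cons e p ih => simp [IsWalk, ih, and_assoc]

theorem weight_append (p q : List E) : Γ.weight (p ++ q) = Γ.weight p + Γ.weight q := by
  simp [weight]

theorem weight_perm {p q : List E} (h : p.Perm q) : Γ.weight p = Γ.weight q :=
  (h.map Γ.w).sum_eq

theorem length_le_weight (p : List E) : p.length ≤ Γ.weight p := by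
  have := List.length_le_sum_of_one_le (p.map Γ.w) (by
    intro a ha
    obtain ⟨e, _, rfl⟩ := List.mem_map.1 ha
    exact Γ.w_pos e)
  rwa [List.length_map] at this

theorem weight_pos {p : List E} (h : p ≠ []) : 0 < Γ.weight p :=
  (List.length_pos_iff.2 h).trans_le (length_le_weight p)

/-- A walk that visits a vertex twice contains a cycle. -/
theorem exists_isCycle_of_not_nodup {x y : V} {p : List E} (hp : Γ.IsWalk x p y)
    (h : ¬ (x :: p.map Γ.t).Nodup) :
    ∃ a c b, p = a ++ c ++ b ∧ Γ.IsCycle c := by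
  induction p generalizing x with
  | nil => simp at h
  | cons e p ih =>
    obtain ⟨rfl, hp'⟩ := hp
    -- If the later vertices are distinct, the start vertex must recur, and the initial segment up
    -- to its return is a cycle.
    by_cases hn : (Γ.t e :: p.map Γ.t).Nodup
    · have hmem : Γ.s e ∈ (e :: p).map Γ.t := by
        by_contra hx
        exact h (List.nodup_cons.2 ⟨hx, hn⟩)
      obtain ⟨f, hf, hfx⟩ := List.mem_map.1 hmem
      obtain ⟨a, b, hab⟩ := List.append_of_mem hf
      have hab' : e :: p = [] ++ (a ++ [f]) ++ b := by simp [hab]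
      refine ⟨[], a ++ [f], b, hab', by simp, ⟨Γ.s e, ?_⟩, ?_⟩
      · have hw : Γ.IsWalk (Γ.s e) (a ++ ([f] ++ b)) y := by
          have : Γ.IsWalk (Γ.s e) (e :: p) y := ⟨rfl, hp'⟩
          rw [hab] at this
          exact this
        obtain ⟨z, h1, h2⟩ := isWalk_append.1 hw
        exact isWalk_append.2 ⟨z, h1, h2.1, hfx⟩
      · have hn' : ((e :: p).map Γ.t).Nodup := hn
        rw [hab', List.nil_append, List.map_append] at hn'
        exact hn'.of_append_left
    · obtain ⟨a, c, b, rfl, hc⟩ := ih hp' hn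
      exact ⟨e :: a, c, b, rfl, hc⟩

theorem exists_isCycle_of_card_le [Fintype V] {x y : V} {p : List E} (hp : Γ.IsWalk x p y)
    (h : Fintype.card V ≤ p.length) : ∃ a c b, p = a ++ c ++ b ∧ Γ.IsCycle c := by
  refine exists_isCycle_of_not_nodup hp fun hn => ?_
  have := hn.length_le_card
  simp only [List.length_cons, List.length_map] at this
  omega

/-- The edges of a nonempty walk determine both of its endpoints. -/
theorem IsCycle.eq_of_isWalk {c : List E} (hc : Γ.IsCycle c) {x y : V} (h : Γ.IsWalk x c y) :
    x = y := by
  obtain ⟨hne, ⟨z, hz⟩, -⟩ := hc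
  have hend : ∀ {c : List E}, c ≠ [] → ∀ {x y z z' : V}, Γ.IsWalk x c y → Γ.IsWalk z c z' →
      x = z ∧ y = z' := by
    intro c
    induction c with
    | nil => simp
    | cons e c ih =>
      rintro - x y z z' ⟨rfl, h1⟩ ⟨rfl, h2⟩
      refine ⟨rfl, ?_⟩
      rcases c with _ | ⟨f, c⟩
      · exact h1.symm.trans h2
      · exact (ih (by simp) h1 h2).2
  obtain ⟨rfl, rfl⟩ := hend hne h hz
  rfl

/-- A closed walk can be rotated so as to start at any of its vertices. -/
theorem exists_rotation {x z : V} {p : List E} (hp : Γ.IsWalk x p x) (hz : z ∈ Γ.supp p) :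
    ∃ p', p.Perm p' ∧ Γ.IsWalk z p' z := by
  obtain ⟨e, he, hez⟩ := hz
  obtain ⟨a, b, rfl⟩ := List.append_of_mem he
  obtain ⟨y, h1, h2, h3⟩ := isWalk_append.1 hp
  rcases hez with rfl | rfl
  · refine ⟨e :: b ++ a, List.perm_append_comm, isWalk_append.2 ⟨x, ⟨rfl, h3⟩, h2 ▸ h1⟩⟩
  · refine ⟨b ++ (a ++ [e]), ?_, isWalk_append.2 ⟨x, h3, isWalk_append.2 ⟨y, h1, h2, rfl⟩⟩⟩
    have : a ++ e :: b = (a ++ [e]) ++ b := by simp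
    rw [this]
    exact List.perm_append_comm

theorem dist_le_iff {x y : V} {i : ℕ} :
    Γ.dist x y ≤ i ↔ ∃ p, Γ.IsWalk x p y ∧ Γ.weight p ≤ i := by
  constructor
  · intro h
    have h1 : Γ.dist x y < (i + 1 : ℕ) := h.trans_lt (by exact_mod_cast Nat.lt_succ_self i)
    simp only [dist, iInf_lt_iff] at h1
    obtain ⟨p, hp, hlt⟩ := h1
    exact ⟨p, hp, Nat.lt_succ_iff.1 (by exact_mod_cast hlt)⟩
  · rintro ⟨p, hp, h⟩
    exact (iInf₂_le p hp).trans (by exact_mod_cast h)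

end WGraph

theorem List.exists_replicate_sublist {α : Type*} [DecidableEq α] (s : Finset α) (N : ℕ) (l : List α)
    (hl : ∀ x ∈ l, x ∈ s) (h : s.card * N < l.length) :
    ∃ x ∈ s, (List.replicate N x).Sublist l := by
  have hsum : ∑ x ∈ s, l.count x = l.length := by
    have := Multiset.sum_count_eq_card (s := s) (m := (l : Multiset α)) (by simpa using hl)
    simpa using this
  obtain ⟨x, hx, hlt⟩ : ∃ x ∈ s, N < l.count x := by
    by_contra! hcon
    have := Finset.sum_le_card_nsmul s _ N hcon
    rw [smul_eq_mul] at this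
    omega
  exact ⟨x, hx, List.replicate_sublist_iff.2 hlt.le⟩

/-! ### Lifting cycles of the quotient and cutting them out of walks. -/

namespace PeriodicGraph

variable {L V E : Type*} [AddCommGroup L] [AddAction L V] [AddAction L E]
variable (Γ : PeriodicGraph L V E)

theorem isWalk_vadd {x y : V} {p : List E} (h : Γ.IsWalk x p y) (u : L) :
    Γ.IsWalk (u +ᵥ x) (p.map (u +ᵥ ·)) (u +ᵥ y) := by
  induction p generalizing x with
  | nil => exact congrArg (u +ᵥ ·) h
  | cons e p ih =>
    obtain ⟨rfl, h⟩ := h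
    refine ⟨Γ.s_vadd u e, ?_⟩
    dsimp only
    rw [Γ.t_vadd]
    exact ih h

theorem weight_vadd (p : List E) (u : L) : Γ.weight (p.map (u +ᵥ ·)) = Γ.weight p := by
  simp only [WGraph.weight, List.map_map]
  congr 2
  funext e
  exact Γ.w_vadd u e

theorem isWalk_quot {x y : V} {p : List E} (h : Γ.IsWalk x p y) :
    Γ.quot.IsWalk (orbitClass L x) (p.map (orbitClass L)) (orbitClass L y) := by
  induction p generalizing x with
  | nil => exact congrArg (orbitClass L) h
  | cons e p ih =>
    obtain ⟨rfl, h⟩ := h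
    exact ⟨rfl, ih h⟩

theorem weight_quot (p : List E) : Γ.quot.weight (p.map (orbitClass L)) = Γ.weight p := by
  simp only [WGraph.weight, List.map_map]
  rfl

theorem mu_perm {p q : List (AddAction.orbitRel.Quotient L E)} (h : p.Perm q) :
    Γ.mu p = Γ.mu q :=
  (h.map _).sum_eq

theorem exists_translation {q : List (AddAction.orbitRel.Quotient L E)} {x : V}
    (h : Γ.quot.IsWalk (orbitClass L x) q (orbitClass L x)) :
    ∃ (u : L) (p : List E), Γ.IsWalk x p (u +ᵥ x) ∧ Γ.weight p = Γ.quot.weight q ∧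
      Γ.mu q = (1 : ℝ) ⊗ₜ[ℤ] u := by
  obtain ⟨p, y, hp, rfl, hy⟩ := Γ.exists_lift q x _ h
  obtain ⟨u, rfl⟩ := orbitClass_eq_iff.1 hy
  exact ⟨u, p, hp, (Γ.weight_quot p).symm, Γ.mu_eq_tmul p x u hp⟩

/-- The translation vector in `L` of a cycle of the quotient graph. -/
theorem exists_mu_eq_tmul {q : List (AddAction.orbitRel.Quotient L E)} (hq : Γ.quot.IsCycle q) :
    ∃ u : L, Γ.mu q = (1 : ℝ) ⊗ₜ[ℤ] u := by
  obtain ⟨-, ⟨z, hz⟩, -⟩ := hq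
  obtain ⟨x, rfl⟩ := Quotient.exists_rep z
  obtain ⟨u, -, -, -, h⟩ := Γ.exists_translation (x := x) hz
  exact ⟨u, h⟩

/-- A long walk contains many cycles of the quotient graph, any of which can be removed. -/
theorem exists_removable_cycles [Module.Free ℤ L]
    (μ : List (AddAction.orbitRel.Quotient L E) → L)
    (hμ : ∀ q, Γ.quot.IsCycle q → Γ.mu q = (1 : ℝ) ⊗ₜ[ℤ] μ q) (m : ℕ) {x y : V} {p : List E}
    (hp : Γ.IsWalk x p y)
    (hl : m * Nat.card (AddAction.orbitRel.Quotient L V) ≤ p.length) :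
    ∃ cs : List (List (AddAction.orbitRel.Quotient L E)), cs.length = m ∧
      (∀ c ∈ cs, Γ.quot.IsCycle c) ∧
      ∀ cs' : List (List (AddAction.orbitRel.Quotient L E)), cs'.Sublist cs →
        ∃ p', Γ.IsWalk x p' (-(cs'.map μ).sum +ᵥ y) ∧
          Γ.weight p' + (cs'.map Γ.quot.weight).sum = Γ.weight p := by
  have := Γ.finite_V
  have := Fintype.ofFinite (AddAction.orbitRel.Quotient L V)
  induction m generalizing x p with
  | zero =>
    refine ⟨[], rfl, by simp, fun cs' h => ?_⟩
    obtain rfl := List.sublist_nil.1 h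
    exact ⟨p, by simpa using hp, by simp⟩
  | succ m ih =>
    set n := Nat.card (AddAction.orbitRel.Quotient L V) with hn
    rw [Nat.succ_mul] at hl
    -- The first `n` edges project to a walk on `n` vertex classes, so they contain one quotient
    -- cycle; the rest supplies the other `m`.
    rw [← List.take_append_drop n p] at hp
    obtain ⟨z, h1, h2⟩ := WGraph.isWalk_append.1 hp
    obtain ⟨cs, hlen, hcyc, hrem⟩ := ih h2 (by rw [List.length_drop]; omega)
    obtain ⟨a', c', b', hsplit, hc'⟩ := WGraph.exists_isCycle_of_card_le (Γ.isWalk_quot h1) (by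
      rw [List.length_map, List.length_take, ← Nat.card_eq_fintype_card]
      omega)
    obtain ⟨ac, b, hacb, hac, rfl⟩ := List.map_eq_append_iff.1 hsplit
    obtain ⟨a, c, rfl, rfl, rfl⟩ := List.map_eq_append_iff.1 hac
    rw [hacb] at h1
    obtain ⟨z₂, h12, hb⟩ := WGraph.isWalk_append.1 h1
    obtain ⟨z₁, ha, hc⟩ := WGraph.isWalk_append.1 h12
    obtain ⟨u, rfl⟩ := orbitClass_eq_iff.1 (hc'.eq_of_isWalk (Γ.isWalk_quot hc)).symm
    have hu : u = μ (c.map (orbitClass L)) := by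
      apply tmul_one_injective L
      dsimp only
      rw [← hμ _ hc', Γ.mu_eq_tmul c z₁ u hc]
    have hwp : Γ.weight p = Γ.weight a + Γ.weight c + Γ.weight b + Γ.weight (p.drop n) := by
      conv_lhs => rw [← List.take_append_drop n p, hacb]
      simp only [WGraph.weight_append]
    refine ⟨c.map (orbitClass L) :: cs, by simp [hlen], by simpa using ⟨hc', hcyc⟩, ?_⟩
    intro cs' hcs'
    rcases List.sublist_cons_iff.1 hcs' with hs | ⟨cs'', rfl, hs⟩
    · obtain ⟨p', hp', hw'⟩ := hrem cs' hs
      refine ⟨a ++ c ++ b ++ p', WGraph.isWalk_append.2 ⟨z, h1, hp'⟩, ?_⟩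
      rw [hwp, ← hw']
      simp only [WGraph.weight_append]
      ring
    · obtain ⟨p', hp', hw'⟩ := hrem cs'' hs
      -- Cutting out a lift of `c` leaves a gap of `u`, closed by translating the remainder of the
      -- walk by `-u`.
      have hb' := Γ.isWalk_vadd (WGraph.isWalk_append.2 ⟨z, hb, hp'⟩) (-u)
      rw [neg_vadd_vadd, vadd_vadd] at hb'
      refine ⟨a ++ (b ++ p').map (-u +ᵥ ·), WGraph.isWalk_append.2 ⟨z₁, ha, ?_⟩, ?_⟩
      · rw [List.map_cons, List.sum_cons, neg_add, ← hu]
        exact hb'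
      · rw [hwp, ← hw', List.map_cons, List.sum_cons, weight_quot, WGraph.weight_append,
          weight_vadd, WGraph.weight_append]
        ring

end PeriodicGraph

/-! ### Translations preserving a set. -/

section StableSets

variable {A X : Type*} [AddCommGroup A] [AddAction A X]

/-- The translations that map a set into itself. -/
def translationSubmonoid (A : Type*) {X : Type*} [AddCommGroup A] [AddAction A X] (T : Set X) :
    AddSubmonoid A where
  carrier := {m | ∀ x ∈ T, m +ᵥ x ∈ T}
  zero_mem' x hx := by rwa [zero_vadd]
  add_mem' ha hb x hx := by rw [add_vadd]; exact ha _ (hb _ hx)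

theorem Reaches.mem_of_stable {ι : Type*} {g : ι → A} {S : Finset ι} {T : Set X}
    (hg : ∀ s ∈ S, g s ∈ translationSubmonoid A T) {x y : X} (h : Reaches g S x y) (hx : x ∈ T) :
    y ∈ T := by
  obtain ⟨a, rfl⟩ := h
  exact (sum_mem fun s hs => nsmul_mem (hg s hs) _ :
    ∑ s ∈ S, a s • g s ∈ translationSubmonoid A T) x hx

/-- A nonzero `m` splits as a generator plus a further stable translation, and the latter is
absorbed into `x`. -/
theorem exists_generator_vadd {ι : Type*} {g : ι → A} {S : Set ι} {T : Set X}
    (hg : ∀ s ∈ S, g s ∈ translationSubmonoid A T) {m : A}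
    (hm : m ∈ AddSubmonoid.closure (g '' S)) (h0 : m ≠ 0) {x : X} (hx : x ∈ T) :
    ∃ s ∈ S, ∃ y ∈ T, g s +ᵥ y = m +ᵥ x := by
  have hle : AddSubmonoid.closure (g '' S) ≤ translationSubmonoid A T := by
    rw [AddSubmonoid.closure_le]
    rintro _ ⟨s, hs, rfl⟩
    exact hg s hs
  have key : m = 0 ∨ ∃ s ∈ S, ∃ m' ∈ translationSubmonoid A T, m = g s + m' := by
    clear h0
    induction hm using AddSubmonoid.closure_induction with
    | mem m hm =>
      obtain ⟨s, hs, rfl⟩ := hm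
      exact Or.inr ⟨s, hs, 0, zero_mem _, (add_zero _).symm⟩
    | zero => exact Or.inl rfl
    | add a b ha hb iha ihb =>
      rcases iha with rfl | ⟨s, hs, m', hm', rfl⟩
      · rwa [zero_add]
      · exact Or.inr ⟨s, hs, m' + b, add_mem hm' (hle hb), add_assoc _ _ _⟩
  obtain ⟨s, hs, m', hm', rfl⟩ := key.resolve_left h0
  exact ⟨s, hs, m' +ᵥ x, hm' x hx, (add_vadd _ _ _).symm⟩

end StableSets

/-! ### The graded ball and its finite generation. -/

namespace PeriodicGraph

variable {L V E : Type*} [AddCommGroup L] [AddAction L V] [AddAction L E]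
variable (Γ : PeriodicGraph L V E)

/-- The componentwise action of `L × ℤ` on `V × ℤ`. -/
abbrev gradedAction (L V : Type*) [AddCommGroup L] [AddAction L V] :
    AddAction (L × ℤ) (V × ℤ) where
  vadd a x := (a.1 +ᵥ x.1, a.2 + x.2)
  zero_vadd x := Prod.ext (zero_vadd L x.1) (zero_add x.2)
  add_vadd a b x := Prod.ext (add_vadd a.1 b.1 x.1) (add_assoc a.2 b.2 x.2)

attribute [local instance] gradedAction

theorem graded_vadd_def (a : L × ℤ) (x : V × ℤ) : a +ᵥ x = (a.1 +ᵥ x.1, a.2 + x.2) := rfl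

/-- The graph of the filtration of `V` by balls: `{(y, i) | d(x₀, y) ≤ i}`. -/
def gradedBall (x₀ : V) : Set (V × ℤ) :=
  {x | ∃ p, Γ.IsWalk x₀ p x.1 ∧ (Γ.weight p : ℤ) ≤ x.2}

theorem mem_gradedBall_natCast {x₀ y : V} {i : ℕ} :
    (y, (i : ℤ)) ∈ Γ.gradedBall x₀ ↔ Γ.dist x₀ y ≤ i := by
  rw [WGraph.dist_le_iff]
  simp [gradedBall]

theorem nonneg_of_mem_gradedBall {x₀ : V} {x : V × ℤ} (hx : x ∈ Γ.gradedBall x₀) : 0 ≤ x.2 := by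
  obtain ⟨p, -, h⟩ := hx
  exact (Int.natCast_nonneg _).trans h

theorem finite_gradedBall (x₀ : V) (i : ℤ) : {x ∈ Γ.gradedBall x₀ | x.2 = i}.Finite := by
  refine ((Γ.finite_walk_ends i.toNat x₀).prod (Set.finite_singleton i)).subset ?_
  rintro ⟨y, j⟩ ⟨⟨p, hp, hw⟩, rfl⟩
  have h := WGraph.length_le_weight (Γ := Γ.toWGraph) p
  exact ⟨⟨p, hp, by dsimp only at hw ⊢; omega⟩, rfl⟩

theorem mem_translationSubmonoid_of_isWalk {x₀ : V} {u : L} {p : List E}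
    (h : Γ.IsWalk x₀ p (u +ᵥ x₀)) :
    (u, (Γ.weight p : ℤ)) ∈ translationSubmonoid (L × ℤ) (Γ.gradedBall x₀) := by
  rintro ⟨y, i⟩ ⟨p', hp', hi⟩
  refine ⟨p ++ p'.map (u +ᵥ ·), WGraph.isWalk_append.2 ⟨_, h, Γ.isWalk_vadd hp' u⟩, ?_⟩
  rw [WGraph.weight_append, weight_vadd]
  simpa [graded_vadd_def] using hi

theorem zero_one_mem_translationSubmonoid (x₀ : V) :
    ((0, 1) : L × ℤ) ∈ translationSubmonoid (L × ℤ) (Γ.gradedBall x₀) := by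
  rintro ⟨y, i⟩ ⟨p, hp, hi⟩
  refine ⟨p, by simpa [graded_vadd_def] using hp, ?_⟩
  simp only [graded_vadd_def] at hi ⊢
  omega

/-- Translation by (0, 1) preserves the graded ball, so its kernel is empty; its cokernel in degree
`i` is the ball of radius `i` without the ball of radius `i - 1`, that is, the sphere. -/
theorem hilbertSeries_gradedBall_mul (x₀ : V) :
    hilbertSeries Prod.snd (Γ.gradedBall x₀) * (1 - PowerSeries.X) = Γ.growthSeries x₀ := by
  have h := hilbertSeries_mul_one_sub (A := L × ℤ) (deg := Prod.snd) (T := Γ.gradedBall x₀)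
    (u := (0, 1)) (d := 1)
    (fun x => by simp only [graded_vadd_def, Nat.cast_one]; ring)
    (fun x hx => Γ.nonneg_of_mem_gradedBall hx) (Γ.finite_gradedBall x₀)
  have hker : {x ∈ Γ.gradedBall x₀ | ((0, 1) : L × ℤ) +ᵥ x ∉ Γ.gradedBall x₀} = ∅ := by
    ext x
    simp only [Set.mem_ofPred_eq, Set.mem_empty_iff_false, iff_false, not_and, not_not]
    exact Γ.zero_one_mem_translationSubmonoid x₀ x
  rw [pow_one] at h
  rw [h, hker]
  ext i
  rw [map_sub]
  have h0 : hilbertSeries Prod.snd (∅ : Set (V × ℤ)) = 0 := by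
    ext i
    simp [hilbertSeries]
  rw [h0, mul_zero, map_zero, sub_zero, hilbertSeries, WGraph.growthSeries, PowerSeries.coeff_mk,
    PowerSeries.coeff_mk, WGraph.growthSeq, Nat.cast_inj,
    ← Set.ncard_image_of_injective (Γ.sphere x₀ i) (Prod.mk_left_injective (i : ℤ))]
  congr 1
  ext ⟨y, j⟩
  simp only [Set.mem_ofPred_eq, Set.mem_image, Prod.mk.injEq, WGraph.sphere]
  constructor
  · rintro ⟨⟨h1, h2⟩, rfl⟩
    rw [mem_gradedBall_natCast] at h1
    refine ⟨y, le_antisymm h1 ?_, rfl, rfl⟩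
    by_contra! hlt
    apply h2
    rcases i with _ | i
    · exact absurd hlt (by simp)
    · have h3 : Γ.dist x₀ y ≤ i := Order.le_of_lt_add_one (by exact_mod_cast hlt)
      rw [← mem_gradedBall_natCast] at h3
      convert h3 using 1
      simp [graded_vadd_def]
  · rintro ⟨y, h1, rfl, rfl⟩
    refine ⟨⟨Γ.mem_gradedBall_natCast.2 h1.le, fun h2 => ?_⟩, rfl⟩
    obtain ⟨p, hp, hw⟩ := h2
    simp only [graded_vadd_def, Prod.fst_neg, Prod.snd_neg, neg_zero, zero_vadd] at hp hw
    have h3 : Γ.dist x₀ y ≤ Γ.weight p := WGraph.dist_le_iff.2 ⟨p, hp, le_rfl⟩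
    rw [h1, Nat.cast_le] at h3
    omega

theorem exists_weight_le : ∃ W : ℕ, ∀ p : List E, Γ.weight p ≤ W * p.length := by
  have := Γ.finite_E
  obtain ⟨W, hW⟩ := (Set.finite_range Γ.quot.w).bddAbove
  refine ⟨W, fun p => ?_⟩
  have := List.sum_le_card_nsmul (p.map Γ.w) W (by
    intro n hn
    obtain ⟨e, -, rfl⟩ := List.mem_map.1 hn
    exact hW ⟨orbitClass L e, rfl⟩)
  rw [List.length_map, smul_eq_mul, mul_comm] at this
  exact this

/-- Elements of large degree of the graded ball are translates of other elements, provided the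
translations generate a multiple of each cycle. -/
theorem exists_descent [Module.Free ℤ L] (x₀ : V) {κ : Type*} (g : κ → L × ℤ) (S : Set κ)
    (hg : ∀ s ∈ S, g s ∈ translationSubmonoid (L × ℤ) (Γ.gradedBall x₀))
    (h01 : ∃ s ∈ S, g s = (0, 1)) (μ : List (AddAction.orbitRel.Quotient L E) → L)
    (hμ : ∀ q, Γ.quot.IsCycle q → Γ.mu q = (1 : ℝ) ⊗ₜ[ℤ] μ q)
    (hcl : ∀ q, Γ.quot.IsCycle q → ∃ N : ℕ, 0 < N ∧
      N • (μ q, (Γ.quot.weight q : ℤ)) ∈ AddSubmonoid.closure (g '' S)) :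
    ∃ K : ℕ, ∀ x ∈ Γ.gradedBall x₀, (K : ℤ) ≤ x.2 →
      ∃ s ∈ S, ∃ y ∈ Γ.gradedBall x₀, g s +ᵥ y = x := by
  classical
  choose! N hN hNmem using hcl
  set C := Γ.finite_cycles.toFinset with hC
  have hCmem : ∀ {q}, q ∈ C ↔ Γ.quot.IsCycle q := by simp [hC]
  -- A single multiple that works for every cycle, so that the pigeonhole below need not know which
  -- cycle repeats.
  set M := ∏ q ∈ C, N q with hM
  have hMpos : 0 < M := Finset.prod_pos fun q hq => hN q (hCmem.1 hq)
  obtain ⟨W, hW⟩ := Γ.exists_weight_le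
  -- Enough edges for `C.card * M + 1` removable cycles, among which some cycle occurs at least `M`
  -- times. A walk of weight above `W * B` has at least this many edges.
  set B := (C.card * M + 1) * Nat.card (AddAction.orbitRel.Quotient L V) with hB
  refine ⟨W * B + 1, ?_⟩
  rintro ⟨y, i⟩ ⟨p, hp, hi⟩ hK
  dsimp only at hp hi hK
  rcases hi.lt_or_eq with hlt | rfl
  · obtain ⟨s, hs, hgs⟩ := h01
    refine ⟨s, hs, (y, i - 1), ⟨p, hp, by dsimp only; omega⟩, ?_⟩
    rw [hgs]
    simp [graded_vadd_def]
  · have hlen : B ≤ p.length := by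
      by_contra! hlt
      have h1 := hW p
      have h2 : W * p.length ≤ W * B := Nat.mul_le_mul_left _ hlt.le
      omega
    obtain ⟨cs, hcs, hcyc, hrem⟩ := Γ.exists_removable_cycles μ hμ _ hp hlen
    obtain ⟨q, hq, hsub⟩ := List.exists_replicate_sublist C M cs
      (fun c hc => hCmem.2 (hcyc c hc)) (by omega)
    obtain ⟨p', hp', hw'⟩ := hrem _ hsub
    rw [List.map_replicate, List.sum_replicate] at hp' hw'
    have hq' := hCmem.1 hq
    have hmem : M • (μ q, (Γ.quot.weight q : ℤ)) ∈ AddSubmonoid.closure (g '' S) := by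
      obtain ⟨k, hk⟩ := Finset.dvd_prod_of_mem N hq
      rw [hM, hk, mul_comm, mul_smul]
      exact nsmul_mem (hNmem q hq') k
    have hne : M • (μ q, (Γ.quot.weight q : ℤ)) ≠ 0 := by
      intro h
      have h1 := congrArg Prod.snd h
      simp only [Prod.smul_mk, Prod.snd_zero, nsmul_eq_mul] at h1
      have h2 : 0 < Γ.quot.weight q := WGraph.weight_pos hq'.1
      have h3 : 0 < (M : ℤ) * Γ.quot.weight q := by positivity
      exact h3.ne' h1
    -- Removing `M` copies of `q` leaves a point of the ball; adding them back is a nonzero monoid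
    -- translation, from which one generator is split off.
    have hx : (-(M • μ q) +ᵥ y, (Γ.weight p' : ℤ)) ∈ Γ.gradedBall x₀ := ⟨p', hp', le_rfl⟩
    obtain ⟨s, hs, z, hz, hsz⟩ := exists_generator_vadd hg hmem hne hx
    refine ⟨s, hs, z, hz, hsz.trans ?_⟩
    simp only [graded_vadd_def, Prod.smul_mk, vadd_neg_vadd, Prod.mk.injEq, true_and]
    rw [← hw']
    push_cast
    simp only [nsmul_eq_mul, smul_eq_mul, Nat.cast_mul]
    ring

/-- The growth polytope is the hull of its extreme points; 0 is added since it need not be one of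
them. -/
theorem nu_mem_convexHull [Module.Finite ℤ L] {q : List (AddAction.orbitRel.Quotient L E)}
    (hq : Γ.quot.IsCycle q) :
    Γ.nu q ∈ convexHull ℝ (insert 0 (Γ.nonzeroVertices : Set (ℝ ⊗[ℤ] L))) := by
  have h1 : Γ.nu q ∈ Γ.growthPolytope := subset_convexHull _ _ (Or.inl ⟨q, hq, rfl⟩)
  rw [growthPolytope, ← convexHull_extremePoints_convexHull
    ((Γ.finite_cycles.image Γ.nu).union (Set.finite_singleton 0))] at h1
  refine convexHull_mono ?_ h1
  intro v hv
  by_cases h0 : v = 0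
  · exact Or.inl h0
  · exact Or.inr ((Set.Finite.mem_toFinset _).2 ⟨hv, h0⟩)

theorem zero_notMem_nonzeroVertices : (0 : ℝ ⊗[ℤ] L) ∉ Γ.nonzeroVertices := fun h =>
  ((Set.Finite.mem_toFinset _).1 h).2 rfl

/-- The growth series is rational, with denominator given by cycles through the start point. -/
theorem exists_growthSeries_mul_prod [Module.Free ℤ L] [Module.Finite ℤ L] (x₀ : V)
    (q : ℝ ⊗[ℤ] L → List (AddAction.orbitRel.Quotient L E))
    (hq : ∀ v ∈ Γ.nonzeroVertices,
      Γ.quot.IsCycle (q v) ∧ Γ.nu (q v) = v ∧ orbitClass L x₀ ∈ Γ.quot.supp (q v)) :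
    ∃ Q : Polynomial ℤ,
      Γ.growthSeries x₀ *
        ∏ v ∈ Γ.nonzeroVertices, (1 - PowerSeries.X ^ Γ.quot.weight (q v)) =
          (Q : PowerSeries ℤ) := by
  classical
  have h0 := Γ.zero_notMem_nonzeroVertices
  have hex : ∀ q, Γ.quot.IsCycle q → ∃ u : L, Γ.mu q = (1 : ℝ) ⊗ₜ[ℤ] u :=
    fun q hq => Γ.exists_mu_eq_tmul hq
  choose! μ hμ using hex
  -- The label 0, never a nonzero vertex, is used for the extra generator (0, 1). Its normalized
  -- vector is 0, so every label equals its own normalized vector.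
  let u : ℝ ⊗[ℤ] L → L := fun v => if v = 0 then 0 else μ (q v)
  let w : ℝ ⊗[ℤ] L → ℕ := fun v => if v = 0 then 1 else Γ.quot.weight (q v)
  have hu : ∀ v ∈ Γ.nonzeroVertices, u v = μ (q v) := fun v hv =>
    if_neg (ne_of_mem_of_not_mem hv h0)
  have hw : ∀ v ∈ Γ.nonzeroVertices, w v = Γ.quot.weight (q v) := fun v hv =>
    if_neg (ne_of_mem_of_not_mem hv h0)
  have hu0 : u 0 = 0 := if_pos rfl
  have hw0 : w 0 = 1 := if_pos rfl
  set S := insert 0 Γ.nonzeroVertices with hS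
  have hwpos : ∀ v ∈ S, 0 < w v := by
    intro v hv
    rcases Finset.mem_insert.1 hv with rfl | hv
    · rw [hw0]; exact one_pos
    · rw [hw v hv]; exact WGraph.weight_pos (hq v hv).1.1
  have hstab : ∀ v ∈ S, (u v, (w v : ℤ)) ∈ translationSubmonoid (L × ℤ) (Γ.gradedBall x₀) := by
    intro v hv
    rcases Finset.mem_insert.1 hv with rfl | hv
    · rw [hu0, hw0]; exact Γ.zero_one_mem_translationSubmonoid x₀
    · obtain ⟨hc, -, hx⟩ := hq v hv
      obtain ⟨z, hz⟩ := hc.2.1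
      -- Rotating the cycle to start at the class of `x₀` changes neither weight nor translation,
      -- and its lift starts at `x₀` itself.
      obtain ⟨q', hperm, hq'⟩ := WGraph.exists_rotation hz hx
      obtain ⟨u', p, hp, hwp, hmu⟩ := Γ.exists_translation hq'
      have hu' : u' = μ (q v) := by
        apply tmul_one_injective L
        dsimp only
        rw [← hmu, ← hμ _ hc, Γ.mu_perm hperm]
      rw [hu v hv, hw v hv, ← hu', WGraph.weight_perm hperm, ← hwp]
      exact Γ.mem_translationSubmonoid_of_isWalk hp
  have himage : (fun v => (w v : ℝ)⁻¹ • (1 : ℝ) ⊗ₜ[ℤ] u v) '' (S : Set (ℝ ⊗[ℤ] L)) =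
      (S : Set (ℝ ⊗[ℤ] L)) := by
    refine (Set.image_congr fun v hv => ?_).trans (Set.image_id _)
    rcases Finset.mem_insert.1 hv with rfl | hv
    · simp [hu0]
    · rw [hu v hv, hw v hv, ← hμ _ (hq v hv).1]
      exact (hq v hv).2.1
  obtain ⟨K, hK⟩ := Γ.exists_descent x₀ (fun v => (u v, (w v : ℤ))) (S : Set (ℝ ⊗[ℤ] L))
    (fun v hv => hstab v hv) ⟨0, Finset.mem_insert_self _ _, by simp [hu0, hw0]⟩ μ hμ (by
      intro c hc
      refine exists_nsmul_mem_closure _ u w (fun v hv => hwpos v hv) (WGraph.weight_pos hc.1) ?_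
      rw [himage, ← hμ c hc, hS, Finset.coe_insert]
      exact Γ.nu_mem_convexHull hc)
  have hdeg : ∀ (v : ℝ ⊗[ℤ] L) (x : V × ℤ), (((u v, (w v : ℤ)) : L × ℤ) +ᵥ x).2 = x.2 + w v :=
    fun v x => add_comm _ _
  obtain ⟨Q, hQ⟩ := exists_hilbertSeries_mul_prod (fun v => (u v, (w v : ℤ))) w Prod.snd hdeg S
    (Γ.gradedBall x₀) (fun x hx => Γ.nonneg_of_mem_gradedBall hx) (Γ.finite_gradedBall x₀)
    (fun x y z hx _ hxy _ => hxy.mem_of_stable hstab hx)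
    (partiallyWellOrderedOn_reaches _ w Prod.snd hdeg S hwpos _
      (fun x hx => Γ.nonneg_of_mem_gradedBall hx) (Γ.finite_gradedBall x₀) K hK)
  refine ⟨Q, ?_⟩
  -- The factor `1 - X` of the label 0 is used up in passing from balls to spheres.
  rw [← hQ, hS, Finset.prod_insert h0, hw0, pow_one, ← mul_assoc, hilbertSeries_gradedBall_mul]
  congr 1
  exact Finset.prod_congr rfl fun v hv => by rw [hw v hv]

/-- With unit weights the weight is the length, and a cycle has distinct edge targets. -/
theorem weight_le_card_of_isCycle (h : Γ.Unweighted)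
    {q : List (AddAction.orbitRel.Quotient L E)} (hq : Γ.quot.IsCycle q) :
    Γ.quot.weight q ≤ Nat.card (AddAction.orbitRel.Quotient L V) := by
  have := Γ.finite_V
  have := Fintype.ofFinite (AddAction.orbitRel.Quotient L V)
  have h1 := hq.2.2.length_le_card
  rw [List.length_map, ← Nat.card_eq_fintype_card] at h1
  refine le_trans ?_ h1
  have h2 := List.sum_le_card_nsmul (q.map Γ.quot.w) 1 (by
    intro n hn
    obtain ⟨e, -, rfl⟩ := List.mem_map.1 hn
    obtain ⟨e, rfl⟩ := Quotient.exists_rep e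
    exact (h e).le)
  simpa [WGraph.weight] using h2

end PeriodicGraph

theorem theorem5p1 {L V E : Type*} [AddCommGroup L] [Module.Free ℤ L] [Module.Finite ℤ L]
    [AddAction L V] [AddAction L E] (Γ : PeriodicGraph L V E) (x₀ : V) (hx₀ : Γ.PInitial x₀) :
    (∀ q : ℝ ⊗[ℤ] L → List (AddAction.orbitRel.Quotient L E),
      (∀ v ∈ Γ.nonzeroVertices,
        Γ.quot.IsCycle (q v) ∧ Γ.nu (q v) = v ∧ orbitClass L x₀ ∈ Γ.quot.supp (q v)) →
      IsQuasiPeriod (fun i => (Γ.growthSeq x₀ i : ℂ))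
        (Γ.nonzeroVertices.lcm fun v => Γ.quot.weight (q v)) ∧
      ∃ Q : Polynomial ℤ,
        Γ.growthSeries x₀ *
            ∏ v ∈ Γ.nonzeroVertices, (1 - PowerSeries.X ^ Γ.quot.weight (q v)) =
          (Q : PowerSeries ℤ)) ∧
    (Γ.Unweighted →
      IsQuasiPeriod (fun i => (Γ.growthSeq x₀ i : ℂ))
        ((Finset.Icc 1 (Nat.card (AddAction.orbitRel.Quotient L V))).lcm id)) := by
  refine ⟨fun q hq => ?_, fun hunw => ?_⟩
  · obtain ⟨Q, hQ⟩ := Γ.exists_growthSeries_mul_prod x₀ q hq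
    refine ⟨IsQuasiPeriod.of_mul_prod (Nat.pos_of_ne_zero ?_) Γ.nonzeroVertices _
      (fun v hv => Finset.dvd_lcm hv) hQ, Q, hQ⟩
    rw [Ne, Finset.lcm_eq_zero_iff]
    rintro ⟨v, hv, h⟩
    exact (WGraph.weight_pos (hq v hv).1.1).ne' h
  -- Any choice of cycles works: their weights lie between 1 and the number of vertex classes, so
  -- they divide the LCM.
  · choose! q hq using hx₀
    obtain ⟨Q, hQ⟩ := Γ.exists_growthSeries_mul_prod x₀ q hq
    refine IsQuasiPeriod.of_mul_prod (Nat.pos_of_ne_zero ?_) Γ.nonzeroVertices _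
      (fun v hv => ?_) hQ
    · rw [Ne, Finset.lcm_eq_zero_iff]
      rintro ⟨n, hn, h⟩
      have := (Finset.mem_Icc.1 (Finset.mem_coe.1 hn)).1
      simp only [id] at h
      omega
    · exact Finset.dvd_lcm (f := id) (Finset.mem_Icc.2
        ⟨WGraph.weight_pos (hq v hv).1.1, Γ.weight_le_card_of_isCycle hunw (hq v hv).1⟩)
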